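/- Let $X$ and $Y$ be infinite locally compact Hausdorff spaces. Let $\beta$ denote the Stone–Čech compactification, with canonical maps $i^X : X \to \beta X$, $i^Y : Y \to \beta Y$ and $i^{X\times Y} : X\times Y \to \beta(X\times Y)$, and let $\phi : \beta(X\times Y) \to \beta X \times \beta Y$ be the natural map, that is, the unique continuous map with $\phi \circ i^{X\times Y} = i^X \times i^Y$. Then $\phi$ is a homeomorphism if and only if both $X$ and $Y$ are pseudocompact, where a space is called pseudocompact if every continuous real-valued function on it is bounded. -/

import Mathlib

/-- A topological space is pseudocompact if every continuous real-valued function on it is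
bounded. -/
def IsPseudocompact (X : Type*) [TopologicalSpace X] : Prop :=
  ∀ f : X → ℝ, Continuous f → ∃ C : ℝ, ∀ x : X, |f x| ≤ C

/-- The product `(x, y) ↦ (i x, i y)` of the canonical maps of `X` and `Y` into their
Stone-Čech compactifications is continuous. -/
theorem continuous_prodMap_stoneCechUnit (X Y : Type*) [TopologicalSpace X]
    [TopologicalSpace Y] :
    Continuous (Prod.map stoneCechUnit stoneCechUnit : X × Y → StoneCech X × StoneCech Y) :=
  continuous_stoneCechUnit.prodMap continuous_stoneCechUnit

/-- The natural map `β(X × Y) → βX × βY`: the unique continuous extension to `β(X × Y)` of the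
product of the canonical maps `X → βX` and `Y → βY`. -/
noncomputable def stoneCechProdMap (X Y : Type*) [TopologicalSpace X] [TopologicalSpace Y] :
    StoneCech (X × Y) → StoneCech X × StoneCech Y :=
  stoneCechExtend (continuous_prodMap_stoneCechUnit X Y)

open Set Filter Topology

/-! The natural map is always onto, and `[0, 1]`-valued functions separate points of `β(X × Y)`, so
it is a homeomorphism iff `ProdExtends X Y`. If `X` is not pseudocompact,
`exists_continuous_prod_eq_ite` gives a continuous `f` with `f (x n, y m) = δ_nm`; its diagonal and
iterated limits differ, so it cannot extend. Conversely, pseudocompactness of `Y` makes `x ↦ f (x,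
·)` continuous into `C(βY, [0, 1])`, and that of `X` makes its range relatively compact, so this map
extends to `βX`. -/

/-- Every continuous `[0, 1]`-valued function on `X × Y` extends continuously to `βX × βY`. -/
def ProdExtends (X Y : Type*) [TopologicalSpace X] [TopologicalSpace Y] : Prop :=
  ∀ f : X × Y → unitInterval, Continuous f →
    ∃ g : StoneCech X × StoneCech Y → unitInterval, Continuous g ∧
      ∀ x y, g (stoneCechUnit x, stoneCechUnit y) = f (x, y)

section

variable {X Y : Type*} [TopologicalSpace X] [TopologicalSpace Y]

theorem ProdExtends.swap (h : ProdExtends X Y) : ProdExtends Y X := by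
  intro f hf
  obtain ⟨g, hg, hgf⟩ := h (f ∘ Prod.swap) (hf.comp continuous_swap)
  exact ⟨g ∘ Prod.swap, hg.comp continuous_swap, fun y x ↦ hgf x y⟩

theorem continuous_stoneCechProdMap : Continuous (stoneCechProdMap X Y) :=
  continuous_stoneCechExtend _

theorem stoneCechProdMap_unit (p : X × Y) :
    stoneCechProdMap X Y (stoneCechUnit p) = (stoneCechUnit p.1, stoneCechUnit p.2) :=
  stoneCechExtend_stoneCechUnit (continuous_prodMap_stoneCechUnit X Y) p

theorem surjective_stoneCechProdMap : Function.Surjective (stoneCechProdMap X Y) := by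
  have hd : DenseRange (Prod.map stoneCechUnit stoneCechUnit :
      X × Y → StoneCech X × StoneCech Y) :=
    denseRange_stoneCechUnit.prodMap denseRange_stoneCechUnit
  have hsub : range (Prod.map stoneCechUnit stoneCechUnit :
      X × Y → StoneCech X × StoneCech Y) ⊆ range (stoneCechProdMap X Y) := by
    rintro _ ⟨p, rfl⟩
    exact ⟨stoneCechUnit p, stoneCechProdMap_unit p⟩
  have hc : IsClosed (range (stoneCechProdMap X Y)) :=
    (isCompact_range continuous_stoneCechProdMap).isClosed
  rw [← range_eq_univ, ← hc.closure_eq]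
  exact (Dense.mono hsub hd).closure_eq

theorem isHomeomorph_stoneCechProdMap_iff :
    IsHomeomorph (stoneCechProdMap X Y) ↔ ProdExtends X Y := by
  constructor
  · intro h f hf
    let e := h.homeomorph
    refine ⟨stoneCechExtend hf ∘ e.symm,
      (continuous_stoneCechExtend hf).comp e.symm.continuous, fun x y ↦ ?_⟩
    have : e.symm (stoneCechUnit x, stoneCechUnit y) = stoneCechUnit (x, y) := by
      rw [Homeomorph.symm_apply_eq]
      exact (stoneCechProdMap_unit (x, y)).symm
    simp [this]
  · intro h
    rw [isHomeomorph_iff_continuous_bijective]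
    refine ⟨continuous_stoneCechProdMap, fun a b hab ↦ ?_, surjective_stoneCechProdMap⟩
    by_contra hne
    obtain ⟨u, hu, hua, hub⟩ :=
      CompletelyRegularSpace.completely_regular a {b} isClosed_singleton hne
    obtain ⟨g, hg, hgu⟩ := h (u ∘ stoneCechUnit) (hu.comp continuous_stoneCechUnit)
    have key : g ∘ stoneCechProdMap X Y = u := by
      refine denseRange_stoneCechUnit.equalizer (hg.comp continuous_stoneCechProdMap) hu ?_
      ext p
      simp [stoneCechProdMap_unit, hgu]
    have h1 : u a = u b := by rw [← key, Function.comp_apply, Function.comp_apply, hab]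
    rw [hua, hub rfl] at h1
    exact zero_ne_one h1

theorem exists_seq_of_not_isPseudocompact (h : ¬ IsPseudocompact X) :
    ∃ u : X → ℝ, Continuous u ∧ ∃ x : ℕ → X, ∀ n m, n < m → u (x n) + 1 ≤ u (x m) := by
  unfold IsPseudocompact at h
  push Not at h
  obtain ⟨u, hu, hunb⟩ := h
  refine ⟨fun x ↦ |u x|, hu.abs, ?_⟩
  obtain ⟨x, -, hx⟩ := exists_seq_of_forall_finset_exists (fun _ : X ↦ True)
    (fun a b ↦ |u a| + 1 ≤ |u b|) (fun s _ ↦ by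
      obtain ⟨M, hM⟩ := (s.image fun a ↦ |u a| + 1).bddAbove
      obtain ⟨y, hy⟩ := hunb M
      exact ⟨y, trivial, fun a ha ↦ (hM (by simpa using ⟨a, ha, rfl⟩)).trans hy.le⟩)
  exact ⟨x, hx⟩

/-- An infinite locally compact Hausdorff space has a sequence that is biorthogonal to a sequence
of continuous functions. -/
theorem exists_biorthogonal_seq (Y : Type*) [TopologicalSpace Y] [T2Space Y]
    [LocallyCompactSpace Y] [Infinite Y] :
    ∃ (y : ℕ → Y) (g : ℕ → C(Y, ℝ)), ∀ n m, g n (y m) = if n = m then 1 else 0 := by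
  -- An infinite Hausdorff space contains an infinite discrete subspace.
  obtain ⟨y, hy⟩ := exists_topology_isEmbedding_nat Y
  have key : ∀ n, ∃ g : C(Y, ℝ), ∀ m, g (y m) = if n = m then 1 else 0 := by
    intro n
    obtain ⟨U, hU, hUn⟩ := hy.isOpen_iff.1 (isOpen_discrete {n})
    have hmem : ∀ m, y m ∈ U ↔ m = n := fun m ↦ by
      rw [← mem_preimage, hUn, mem_singleton_iff]
    obtain ⟨g, hg1, hg0, -⟩ := exists_continuous_one_zero_of_isCompact
      (isCompact_singleton (x := y n)) hU.isClosed_compl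
      (by simpa using (hmem n).2 rfl)
    refine ⟨g, fun m ↦ ?_⟩
    split_ifs with hnm
    · subst hnm
      exact hg1 rfl
    · exact hg0 fun hm ↦ hnm ((hmem m).1 hm).symm
  choose g hg using key
  exact ⟨y, g, hg⟩

theorem exists_continuous_prod_eq_ite [T2Space Y] [LocallyCompactSpace Y] [Infinite Y]
    (h : ¬ IsPseudocompact X) :
    ∃ (x : ℕ → X) (y : ℕ → Y) (f : X × Y → ℝ), Continuous f ∧
      ∀ n m, f (x n, y m) = if n = m then 1 else 0 := by
  obtain ⟨u, hu, x, hx⟩ := exists_seq_of_not_isPseudocompact h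
  obtain ⟨y, g, hg⟩ := exists_biorthogonal_seq Y
  let b : ℕ → X → ℝ := fun n a ↦ max 0 (1 - |u a - u (x n)|)
  have hb : ∀ n, Continuous (b n) := fun n ↦ by fun_prop
  have hbn : ∀ n m, b n (x m) = if n = m then 1 else 0 := by
    intro n m
    split_ifs with hnm
    · simp [b, hnm]
    · have : 1 ≤ |u (x m) - u (x n)| := by
        rcases lt_or_gt_of_ne hnm with hlt | hlt
        · exact le_trans (by linarith [hx _ _ hlt]) (le_abs_self _)
        · exact le_trans (by linarith [hx _ _ hlt]) (neg_le_abs _)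
      exact max_eq_left (by linarith)
  have hgrow : ∀ n : ℕ, u (x 0) + n ≤ u (x n) := by
    intro n
    induction n with
    | zero => simp
    | succ n ih => push_cast; linarith [hx n (n + 1) n.lt_succ_self]
  -- Only the `X` factor gives local finiteness: `u (x n)` tends to infinity, while `b n` lives
  -- where `u` is within `1` of `u (x n)`.
  have hlf : LocallyFinite fun n ↦ Function.support fun p : X × Y ↦ b n p.1 * g n p.2 := by
    intro p
    refine ⟨{q | u q.1 < u p.1 + 1},
      (isOpen_lt (by fun_prop) continuous_const).mem_nhds (by simp), ?_⟩
    obtain ⟨N, hN⟩ := exists_nat_gt (u p.1 + 2 - u (x 0))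
    refine (finite_Iio N).subset ?_
    rintro n ⟨q, hq, hq'⟩
    have hbq : 0 < 1 - |u q.1 - u (x n)| := by
      by_contra hle
      exact hq (by simp [b, max_eq_left (not_lt.1 hle)])
    have h1 := neg_le_abs (u q.1 - u (x n))
    have h2 : u q.1 < u p.1 + 1 := hq'
    have h3 := hgrow n
    have : (n : ℝ) < N := by linarith
    exact_mod_cast this
  refine ⟨x, y, fun p ↦ ∑ᶠ n, b n p.1 * g n p.2,
    continuous_finsum (fun n ↦ by have := hb n; fun_prop) hlf, fun n m ↦ ?_⟩
  dsimp only
  rw [finsum_eq_single _ n fun k hk ↦ by simp [hbn, hk]]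
  simp [hbn, hg]

theorem ProdExtends.isPseudocompact_left [T2Space Y] [LocallyCompactSpace Y] [Infinite Y]
    (h : ProdExtends X Y) : IsPseudocompact X := by
  by_contra hX
  obtain ⟨x, y, f, hf, hxy⟩ := exists_continuous_prod_eq_ite (Y := Y) hX
  obtain ⟨g, hg, hgf⟩ := h (fun p ↦ projIcc 0 1 zero_le_one (f p)) (continuous_projIcc.comp hf)
  let U : Ultrafilter ℕ := hyperfilter ℕ
  obtain ⟨a, ha⟩ : ∃ a, Tendsto (fun n ↦ stoneCechUnit (x n)) (U : Filter ℕ) (𝓝 a) :=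
    ⟨_, (U.map fun n ↦ stoneCechUnit (x n)).le_nhds_lim⟩
  obtain ⟨b, hb⟩ : ∃ b, Tendsto (fun n ↦ stoneCechUnit (y n)) (U : Filter ℕ) (𝓝 b) :=
    ⟨_, (U.map fun n ↦ stoneCechUnit (y n)).le_nhds_lim⟩
  have hdiag : g (a, b) = 1 := by
    refine tendsto_nhds_unique ((hg.tendsto (a, b)).comp (ha.prodMk_nhds hb)) ?_
    refine tendsto_const_nhds.congr fun n ↦ ?_
    simp [hgf, hxy, projIcc_right]
  have hrow : ∀ n, g (stoneCechUnit (x n), b) = 0 := by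
    intro n
    refine tendsto_nhds_unique
      ((hg.tendsto (stoneCechUnit (x n), b)).comp (tendsto_const_nhds.prodMk_nhds hb)) ?_
    refine tendsto_const_nhds.congr' ?_
    -- Nonprincipality of `U` discards the single nonzero entry of the row.
    have : ∀ᶠ m in (U : Filter ℕ), m ≠ n :=
      hyperfilter_le_cofinite (by simp)
    filter_upwards [this] with m hm
    simp [hgf, hxy, projIcc_left, hm.symm]
  have hzero : g (a, b) = 0 := by
    refine tendsto_nhds_unique
      ((hg.tendsto (a, b)).comp (ha.prodMk_nhds tendsto_const_nhds)) ?_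
    exact tendsto_const_nhds.congr fun n ↦ (hrow n).symm
  exact zero_ne_one (hzero.symm.trans hdiag)

/-- Otherwise some sequence `F (x n)` is `ε`-separated, and bumps of height `n` around the `x n` sum
to an unbounded continuous function. -/
theorem IsPseudocompact.totallyBounded_range {M : Type*} [PseudoMetricSpace M]
    (hX : IsPseudocompact X) {F : X → M} (hF : Continuous F) : TotallyBounded (range F) := by
  rw [Metric.totallyBounded_iff]
  by_contra! hcon
  obtain ⟨ε, hε, hcov⟩ := hcon
  obtain ⟨x, -, hx⟩ := exists_seq_of_forall_finset_exists (fun _ : X ↦ True)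
    (fun a b ↦ ε ≤ dist (F a) (F b)) (fun s _ ↦ by
      by_contra! hs
      refine hcov (F '' s) (s.finite_toSet.image F) ?_
      rintro _ ⟨z, rfl⟩
      obtain ⟨a, ha, haz⟩ := hs z trivial
      exact mem_biUnion (mem_image_of_mem F ha) (by rwa [Metric.mem_ball']))
  -- Radius `ε / 4`: if an `ε / 4`-ball meets two supports, four such distances add up to less than
  -- `ε`, so the centres coincide.
  let b : ℕ → X → ℝ := fun n a ↦ n * max 0 (1 - 4 / ε * dist (F a) (F (x n)))
  have hsupp : ∀ n a, b n a ≠ 0 → dist (F a) (F (x n)) < ε / 4 := by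
    intro n a hne
    by_contra! hle
    refine hne ?_
    have : 1 ≤ 4 / ε * dist (F a) (F (x n)) := by
      calc 1 = 4 / ε * (ε / 4) := by field_simp
        _ ≤ _ := by gcongr
    simp [b, max_eq_left (sub_nonpos.2 this)]
  have hsep : ∀ n m, dist (F (x n)) (F (x m)) < ε → n = m := by
    intro n m hlt
    by_contra hne
    rcases lt_or_gt_of_ne hne with h | h
    · exact (hx _ _ h).not_gt hlt
    · exact (hx _ _ h).not_gt (by rwa [dist_comm])
  have hlf : LocallyFinite fun n ↦ Function.support (b n) := by
    intro p
    refine ⟨F ⁻¹' Metric.ball (F p) (ε / 4),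
      hF.continuousAt.preimage_mem_nhds (Metric.ball_mem_nhds _ (by positivity)), ?_⟩
    refine Set.Subsingleton.finite ?_
    rintro n ⟨q, hq, hq'⟩ m ⟨r, hr, hr'⟩
    refine hsep n m ?_
    have h1 := hsupp n q hq
    have h2 := hsupp m r hr
    rw [mem_preimage, Metric.mem_ball] at hq' hr'
    have h3 := dist_triangle4 (F (x n)) (F q) (F p) (F (x m))
    have h4 := dist_triangle (F p) (F r) (F (x m))
    rw [dist_comm (F (x n)) (F q)] at h3
    rw [dist_comm (F p) (F r)] at h4
    linarith
  obtain ⟨C, hC⟩ := hX (fun a ↦ ∑ᶠ n, b n a)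
    (continuous_finsum (fun n ↦ by fun_prop) hlf)
  obtain ⟨N, hN⟩ := exists_nat_gt C
  have hval : ∑ᶠ n, b n (x N) = N := by
    rw [finsum_eq_single _ N fun k hk ↦ ?_]
    · simp [b]
    · by_contra hne
      have h1 := hsupp k (x N) hne
      exact hk (hsep N k (by linarith)).symm
  have h1 := (le_abs_self _).trans (hC (x N))
  rw [hval] at h1
  linarith

/-- If `Y` is pseudocompact and `X` is locally compact, then the sections `f (·, y)` of a
continuous function on `X × Y` are equicontinuous. -/
theorem IsPseudocompact.exists_nhds_forall_dist_lt [LocallyCompactSpace X]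
    (hY : IsPseudocompact Y) {f : X × Y → ℝ} (hf : Continuous f) (x₀ : X) {ε : ℝ} (hε : 0 < ε) :
    ∀ᶠ x in 𝓝 x₀, ∀ y, dist (f (x, y)) (f (x₀, y)) < ε := by
  obtain ⟨K, hK, hKx⟩ := exists_compact_mem_nhds x₀
  have : CompactSpace K := isCompact_iff_compactSpace.1 hK
  -- The functions `f (·, y)` on `K` form a totally bounded family, so a finite `ε / 3`-net reduces
  -- equicontinuity at `x₀` to finitely many functions.
  let F : C(Y, C(K, ℝ)) := ContinuousMap.curry ⟨fun p : Y × K ↦ f (p.2, p.1), by fun_prop⟩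
  obtain ⟨t, ht, hcov⟩ :=
    Metric.totallyBounded_iff.1 (hY.totallyBounded_range F.continuous) (ε / 3) (by positivity)
  let k₀ : K := ⟨x₀, mem_of_mem_nhds hKx⟩
  have hloc : ∀ᶠ k in 𝓝 k₀, ∀ φ ∈ t, dist (φ k) (φ k₀) < ε / 3 := by
    rw [eventually_all_finite ht]
    intro φ _
    exact φ.continuous.continuousAt.eventually (Metric.ball_mem_nhds _ (by positivity))
  rw [nhds_subtype_eq_comap, eventually_comap] at hloc
  filter_upwards [hloc, hKx] with x hx hxK y
  obtain ⟨φ, hφ, hFφ⟩ := mem_iUnion₂.1 (hcov (mem_range_self y))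
  rw [Metric.mem_ball] at hFφ
  have h1 : dist (f (x, y)) (φ ⟨x, hxK⟩) < ε / 3 :=
    (ContinuousMap.dist_apply_le_dist (f := F y) (g := φ) ⟨x, hxK⟩).trans_lt hFφ
  have h2 : dist (f (x₀, y)) (φ k₀) < ε / 3 :=
    (ContinuousMap.dist_apply_le_dist (f := F y) (g := φ) k₀).trans_lt hFφ
  have h3 := hx ⟨x, hxK⟩ rfl φ hφ
  have h4 := dist_triangle4 (f (x, y)) (φ ⟨x, hxK⟩) (φ k₀) (f (x₀, y))
  rw [dist_comm (φ k₀)] at h4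
  linarith

theorem prodExtends_of_isPseudocompact [LocallyCompactSpace X]
    (hX : IsPseudocompact X) (hY : IsPseudocompact Y) : ProdExtends X Y := by
  intro f hf
  have hsec : ∀ x, Continuous fun y ↦ f (x, y) := fun x ↦ by fun_prop
  let G : X → C(StoneCech Y, unitInterval) := fun x ↦
    ⟨stoneCechExtend (hsec x), continuous_stoneCechExtend _⟩
  have hGf : ∀ x y, G x (stoneCechUnit y) = f (x, y) := fun x y ↦
    stoneCechExtend_stoneCechUnit (hsec x) y
  have hG : Continuous G := by
    rw [continuous_iff_continuousAt]
    intro x₀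
    rw [ContinuousAt, Metric.tendsto_nhds]
    intro ε hε
    have hf' : Continuous fun p ↦ (f p : ℝ) := continuous_subtype_val.comp hf
    filter_upwards [hY.exists_nhds_forall_dist_lt hf' x₀ (half_pos hε)] with x hx
    -- Density of `Y` in `βY` preserves only `≤`, hence the bound `ε / 2`.
    refine lt_of_le_of_lt ((ContinuousMap.dist_le (half_pos hε).le).2 fun z ↦ ?_) (half_lt_self hε)
    induction z using denseRange_stoneCechUnit.induction_on with
    | hp => exact isClosed_le (by fun_prop) continuous_const
    | ih y =>
      rw [hGf, hGf]
      exact (hx y).le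
  have hcpt : IsCompact (closure (range G)) :=
    (hX.totallyBounded_range hG).closure.isCompact_of_isComplete isClosed_closure.isComplete
  have : CompactSpace (closure (range G)) := isCompact_iff_compactSpace.1 hcpt
  -- Extension to `βX` requires a compact codomain.
  let G' : X → closure (range G) := fun x ↦ ⟨G x, subset_closure (mem_range_self x)⟩
  have hG' : Continuous G' := hG.subtype_mk _
  refine ⟨fun p ↦ (stoneCechExtend hG' p.1).1 p.2, ?_, fun x y ↦ ?_⟩
  · have := continuous_stoneCechExtend hG'
    fun_prop
  · dsimp only
    rw [stoneCechExtend_stoneCechUnit]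
    exact hGf x y

end

theorem theorem4 {X Y : Type*} [TopologicalSpace X] [TopologicalSpace Y]
    [T2Space X] [T2Space Y] [LocallyCompactSpace X] [LocallyCompactSpace Y]
    [Infinite X] [Infinite Y] :
    IsHomeomorph (stoneCechProdMap X Y) ↔ IsPseudocompact X ∧ IsPseudocompact Y := by
  rw [isHomeomorph_stoneCechProdMap_iff]
  exact ⟨fun h ↦ ⟨h.isPseudocompact_left, h.swap.isPseudocompact_left⟩,
    fun h ↦ prodExtends_of_isPseudocompact h.1 h.2⟩
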